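/- All theories are first-order theories in the language $\{\in\}$ with equality. Let $Ord(x)$ say that $x$ is transitive and $\forall y,z\in x\,(y\in z\vee y=z\vee z\in y)$; let $Succ(x)$ be $\exists y\in x\,(x=y\cup\{y\})$; let $Nat(x)$ be $Ord(x)\wedge\forall y\,[(y\in x\vee y=x)\to(y=\emptyset\vee Succ(y))]$; and let $\omega$ be the class $\{x: Nat(x)\}$. EST is the theory with the axioms Extensionality, Empty Set, Pairing, Union, Cartesian Product (for all $x,y$, $x\times y$ is a set), the scheme of $\Delta_0$-Separation (with parameters), and the scheme of Induction along $\omega$: for every formula $\phi$ (with parameters) such that $\phi(x)\to Nat(x)$ for all $x$, $$[\phi(\emptyset)\wedge(\forall x\in\omega)(\phi(x)\to\phi(x\cup\{x\}))]\to(\forall x\in\omega)\,\phi(x).$$ For a set $A$, let $L_A$ be a first-order language with equality having at most one unary predicate $\mathbf U$, at most one binary predicate $\mathbf R$, a constant $\mathbf c_a$ for each $a\in A$, and variables $v_n$ $(n\in\omega)$. An $L_A$-structure is a tuple $\langle M,U,R,I\rangle$ with $U\subseteq M$, $R\subseteq M\times M$ and $I:A\to M$ (where $U$ or $R$ is omitted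 if the corresponding predicate is missing from $L_A$). The formulas of $L_A$, satisfaction in $L_A$-structures and elementary embeddings are defined inside the set theory, formulas being coded by sets via formation sequences of length in $\omega$, and assignments by finite tuples of elements of $M$. Vopěnka's Principle VP is the scheme consisting, for every formula $\phi(x)$ of $\{\in\}$ in one free variable and each of the four choices of which of $\mathbf U$, $\mathbf R$ are present, of the sentence: for every set $A$, if $\{x:\phi(x)\}$ is a proper class (that is, not equal to any set), all of whose members are $L_A$-structures, then there are distinct $\mathcal M,\mathcal N$ with $\phi(\mathcal M)$, $\phi(\mathcal N)$ and an elementary embedding of $\mathcal M$ into $\mathcal N$. **Theorem.** EST + VP proves (that is, every model of EST + VP satisfies) that the class $\omega$ is a set: $\exists w\,\forall x\,(x\in w\leftrightarrow Nat(x))$. Therefore EST + VP proves Infinity: there is a set that contains $\emptyset$ and is closed under $x\mapsto x\cup\{x\}$. -/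

import Mathlib

open FirstOrder FirstOrder.Language

namespace WeakSet

/-! ### The language of set theory -/

/-- The only non-logical symbol: the binary membership relation. -/
inductive SetRel : ℕ → Type
  | mem : SetRel 2

/-- The first-order language `{∈}` (equality is a logical symbol). -/
def setLang : FirstOrder.Language.{0, 0} := ⟨fun _ => Empty, SetRel⟩

/-- Formulas of `{∈}` whose free variables are `0, …, n-1`. -/
abbrev Fm (n : ℕ) : Type := setLang.BoundedFormula Empty n

/-- A variable in a context of length `n` is also a variable in the context of length `n + 1`. -/
scoped instance liftVar (n : ℕ) : Coe (Fin n) (Fin (n + 1)) := ⟨Fin.castSucc⟩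

section Logic

variable {n : ℕ}

/-- `x ∈ y` -/
def mem (x y : Fin n) : Fm n :=
  Relations.boundedFormula₂ (SetRel.mem : setLang.Relations 2) (&x) (&y)

/-- `x = y` -/
def eq (x y : Fin n) : Fm n := Term.bdEqual (&x) (&y)

/-- Universal quantifier, binding the new variable. -/
def all (φ : Fin (n + 1) → Fm (n + 1)) : Fm n := (φ (Fin.last n)).all

/-- Existential quantifier, binding the new variable. -/
def ex (φ : Fin (n + 1) → Fm (n + 1)) : Fm n := (φ (Fin.last n)).ex

/-- `∀ y ∈ x, φ y` -/
def ball (x : Fin n) (φ : Fin (n + 1) → Fm (n + 1)) : Fm n := all fun y => mem y x ⟹ φ y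

/-- `∃ y ∈ x, φ y` -/
def bex (x : Fin n) (φ : Fin (n + 1) → Fm (n + 1)) : Fm n := ex fun y => mem y x ⊓ φ y

/-- The formula `φ(x 0, …, x (k-1))`, obtained from `φ` by substituting variables. -/
def inst {k : ℕ} (φ : setLang.Formula (Fin k)) (x : Fin k → Fin n) : Fm n :=
  BoundedFormula.relabel (n := n) (k := 0) (fun i => Sum.inr (x i)) φ

end Logic

/-- The `Δ₀` formulas: those built from atomic formulas by connectives and bounded
quantification `∀ y ∈ t`, where `t` is a variable other than `y`
(bounded existential quantifiers are obtained by means of negation). -/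
inductive IsDelta0 {α : Type} : ∀ {n : ℕ}, setLang.BoundedFormula α n → Prop
  | falsum {n : ℕ} : IsDelta0 (⊥ : setLang.BoundedFormula α n)
  | eq {n : ℕ} (s t : α ⊕ Fin n) :
      IsDelta0 (Term.bdEqual (Term.var s : setLang.Term (α ⊕ Fin n)) (Term.var t))
  | mem {n : ℕ} (s t : α ⊕ Fin n) :
      IsDelta0 (Relations.boundedFormula₂ (SetRel.mem : setLang.Relations 2)
        (Term.var s : setLang.Term (α ⊕ Fin n)) (Term.var t))
  | imp {n : ℕ} {φ ψ : setLang.BoundedFormula α n} :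
      IsDelta0 φ → IsDelta0 ψ → IsDelta0 (φ ⟹ ψ)
  | ball {n : ℕ} (t : α ⊕ Fin n) {φ : setLang.BoundedFormula α (n + 1)} :
      IsDelta0 φ → IsDelta0 (BoundedFormula.all
        (Relations.boundedFormula₂ (SetRel.mem : setLang.Relations 2)
          (Term.var (Sum.inr (Fin.last n)) : setLang.Term (α ⊕ Fin (n + 1)))
          (Term.var (Sum.map id Fin.castSucc t)) ⟹ φ))

/-! ### Elementary notions of set theory, as formulas -/

section Basic

variable {n : ℕ}

/-- `x = ∅` -/
def isEmpty (x : Fin n) : Fm n := all fun y => ∼(mem y x)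

/-- `x ⊆ y` -/
def sub (x y : Fin n) : Fm n := ball x fun z => mem z y

/-- `p = {a, b}` -/
def isUPair (p a b : Fin n) : Fm n := all fun z => mem z p ⇔ (eq z a ⊔ eq z b)

/-- `p = ⟨a, b⟩ = {{a}, {a, b}}` -/
def isPair (p a b : Fin n) : Fm n :=
  ex fun s => ex fun t => isUPair s a a ⊓ isUPair t a b ⊓ isUPair p s t

/-- `p = ⟨a, b, c⟩ = ⟨⟨a, b⟩, c⟩` -/
def isTriple (p a b c : Fin n) : Fm n := ex fun q => isPair q a b ⊓ isPair p q c

/-- `p = ⟨a, b, c, d⟩ = ⟨⟨a, b, c⟩, d⟩` -/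
def isQuad (p a b c d : Fin n) : Fm n := ex fun q => isTriple q a b c ⊓ isPair p q d

/-- `c = a × b` -/
def isProd (c a b : Fin n) : Fm n :=
  all fun z => mem z c ⇔ bex a fun x => bex b fun y => isPair z x y

/-- `y = x ∪ {x}` -/
def isSucc (y x : Fin n) : Fm n := all fun z => mem z y ⇔ (mem z x ⊔ eq z x)

/-- `Tr(x)`: `x` is a transitive set. -/
def Tr (x : Fin n) : Fm n := ball x fun y => sub y x

/-- `Ord(x)`: `x` is transitive and linearly ordered by `∈`. -/
def Ord (x : Fin n) : Fm n :=
  Tr x ⊓ ball x fun y => ball x fun z => mem y z ⊔ (eq y z ⊔ mem z y)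

/-- `Succ(x)`: `x = y ∪ {y}` for some `y ∈ x`. -/
def Succ (x : Fin n) : Fm n := bex x fun y => isSucc x y

/-- `Nat(x)`: `x` is a natural number. -/
def Nat (x : Fin n) : Fm n :=
  Ord x ⊓ all fun y => (mem y x ⊔ eq y x) ⟹ (isEmpty y ⊔ Succ y)

/-- `x` is the numeral `k`. -/
def isNum : ∀ {n : ℕ}, ℕ → Fin n → Fm n
  | _, 0, x => isEmpty x
  | _, k + 1, x => ex fun y => isNum k y ⊓ isSucc x y

/-- `⟨x, y⟩ ∈ f` -/
def app (f x y : Fin n) : Fm n := bex f fun p => isPair p x y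

/-- `f` is a function with domain `d`. -/
def isFunOn (f d : Fin n) : Fm n :=
  (ball f fun p => bex d fun x => ex fun y => isPair p x y) ⊓
  (ball d fun x => ex fun y => app f x y ⊓ all fun z => app f x z ⟹ eq z y)

/-- `f : a → b` -/
def isFun (f a b : Fin n) : Fm n :=
  isFunOn f a ⊓ ball a fun x => all fun y => app f x y ⟹ mem y b

/-- `f` is one-to-one (for a function `f`). -/
def isInj (f : Fin n) : Fm n :=
  all fun x => all fun y => all fun z => (app f x z ⊓ app f y z) ⟹ eq x y

end Basic

/-! ### Finite tuples

For `m ∈ ω`, the elements of `ᵐM` are the tuples `⟨⟨0, x₀⟩, …, ⟨m-1, x_{m-1}⟩⟩` with all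
`xᵢ ∈ M`, formed by starting with `∅` and passing from `y` to `⟨y, ⟨k, xₖ⟩⟩` at step `k`. -/

section Tuples

variable {n : ℕ}

/-- Step `k` of the construction `s` of a tuple appends `⟨k, x⟩`, that is,
`s(k+1) = ⟨s(k), ⟨k, x⟩⟩`. -/
def tupleStep (s k x : Fin n) : Fm n :=
  ex fun k' => ex fun y => ex fun y' => ex fun p =>
    isSucc k' k ⊓ app s k y ⊓ app s k' y' ⊓ isPair p k x ⊓ isPair y' y p

/-- `s` is the sequence, with domain `m + 1`, of the initial parts of the tuple `h ∈ ᵐM`. -/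
def isTupleSeq (M m h s : Fin n) : Fm n :=
  (ex fun m' => isSucc m' m ⊓ isFunOn s m') ⊓
  (ex fun z => isEmpty z ⊓ app s z z) ⊓
  app s m h ⊓
  (ball m fun k => bex M fun x => tupleStep s k x)

/-- `h ∈ ᵐM` -/
def isTuple (M m h : Fin n) : Fm n := ex fun s => isTupleSeq M m h s

/-- `h ∈ ᵐM`, `i < m` and `h(i) = x`. -/
def coord (M m h i x : Fin n) : Fm n :=
  mem i m ⊓ ex fun s => isTupleSeq M m h s ⊓ tupleStep s i x

/-- `h, h' ∈ ᵐM` and `h' = h(i/x)`. -/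
def isUpdate (M m h i x h' : Fin n) : Fm n :=
  isTuple M m h ⊓ isTuple M m h' ⊓ coord M m h' i x ⊓
  ball m fun j => ∼(eq j i) ⟹ all fun y => coord M m h j y ⇔ coord M m h' j y

end Tuples

/-! ### The languages `L_A`, coded by sets

A language has the constants `c_a` for `a ∈ A`, and at most one unary predicate `U` and at most
one binary predicate `R`. Which of the two are present is recorded by a `Sig`. -/

/-- Which of the predicates `U` (unary) and `R` (binary) the language contains. -/
structure Sig where
  /-- `U` is present. -/
  hasU : Bool
  /-- `R` is present. -/
  hasR : Bool

section Languages

variable {n : ℕ}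

/-- `t` is the variable `v_i = ⟨0, i⟩`. -/
def isVar (t i : Fin n) : Fm n := ex fun z => isNum 0 z ⊓ isPair t z i

/-- `t` is the constant `c_a = ⟨1, a⟩`. -/
def isConst (t a : Fin n) : Fm n := ex fun z => isNum 1 z ⊓ isPair t z a

/-- `t` is a term of `L_A`. -/
def isTerm (A t : Fin n) : Fm n :=
  (ex fun i => Nat i ⊓ isVar t i) ⊔ (bex A fun a => isConst t a)

/-- `y` codes `t ≡ s`, that is, `y = ⟨2, t, s⟩`. -/
def codeEq (y t s : Fin n) : Fm n := ex fun z => isNum 2 z ⊓ isTriple y z t s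

/-- `y` codes `¬ x`, that is, `y = ⟨3, x⟩`. -/
def codeNot (y x : Fin n) : Fm n := ex fun z => isNum 3 z ⊓ isPair y z x

/-- `y` codes `x₁ ∧ x₂`, that is, `y = ⟨4, x₁, x₂⟩`. -/
def codeAnd (y x₁ x₂ : Fin n) : Fm n := ex fun z => isNum 4 z ⊓ isTriple y z x₁ x₂

/-- `y` codes `∃ v_i x`, that is, `y = ⟨5, i, x⟩`. -/
def codeEx (y i x : Fin n) : Fm n := ex fun z => isNum 5 z ⊓ isTriple y z i x

/-- `y` codes `U(t)`, that is, `y = ⟨6, t⟩`. -/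
def codeU (y t : Fin n) : Fm n := ex fun z => isNum 6 z ⊓ isPair y z t

/-- `y` codes `R(t, s)`, that is, `y = ⟨7, t, s⟩`. -/
def codeR (y t s : Fin n) : Fm n := ex fun z => isNum 7 z ⊓ isTriple y z t s

/-- `x` is an atomic formula of `L_A`. -/
def isAtomic (S : Sig) (A x : Fin n) : Fm n :=
  (ex fun t => ex fun s => isTerm A t ⊓ isTerm A s ⊓ codeEq x t s) ⊔
  ((if S.hasU then ex fun t => isTerm A t ⊓ codeU x t else ⊥) ⊔
   (if S.hasR then ex fun t => ex fun s => isTerm A t ⊓ isTerm A s ⊓ codeR x t s else ⊥))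

/-- `n' ∈ ω`, `n' ≠ 0`, and `f` is a function with domain `n'` that is a formation sequence of the
formula `x` of `L_A`: its last value is `x`, and each value is an atomic formula or arises from
earlier values by `¬`, `∧` or some `∃ v_i`. -/
def isFormSeq (S : Sig) (A x f n' : Fin n) : Fm n :=
  Nat n' ⊓ isFunOn f n' ⊓ (ex fun k => isSucc n' k ⊓ app f k x) ⊓
  ball n' fun k => ex fun y => app f k y ⊓
    (isAtomic S A y ⊔
    ((bex k fun j => ex fun z => app f j z ⊓ codeNot y z) ⊔
    ((bex k fun j => bex k fun l => ex fun z => ex fun w =>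
        app f j z ⊓ app f l w ⊓ codeAnd y z w) ⊔
     (bex k fun j => ex fun z => ex fun i => Nat i ⊓ app f j z ⊓ codeEx y i z))))

/-- The outermost constructor of the formula `y` mentions `v_i`: either `y` is atomic and `v_i`
is one of its terms, or `y` is of the form `∃ v_i z`. -/
def mentions (y i : Fin n) : Fm n :=
  (ex fun t => isVar t i ⊓
    ((ex fun s => codeEq y t s ⊔ codeEq y s t) ⊔
    (codeU y t ⊔ (ex fun s => codeR y t s ⊔ codeR y s t)))) ⊔
  (ex fun z => codeEx y i z)

/-- All variables occurring (free or bound) in the formulas enumerated by `f`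
are among `v_0, …, v_{m-1}`. -/
def boundsVars (f m : Fin n) : Fm n :=
  all fun k => all fun y => all fun i => (app f k y ⊓ mentions y i) ⟹ mem i m

/-- `x` is a formula of `L_A` all of whose variables are among `v_0, …, v_{m-1}`. -/
def isFormula (S : Sig) (A m x : Fin n) : Fm n :=
  ex fun f => ex fun n' => isFormSeq S A x f n' ⊓ boundsVars f m

end Languages

/-! ### Structures, satisfaction and elementary embeddings -/

section Structures

variable {n : ℕ}

/-- `X` is the `L_A`-structure with domain `M`, `U ⊆ M`, `R ⊆ M × M` and constant assignment
`I : A → M`, that is, the tuple `⟨M, U, R, I⟩`; if `U` or `R` is missing from the language, then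
it is missing from the tuple (and is taken to be `∅`, for definiteness). -/
def isStruct (S : Sig) (A X M U R I : Fin n) : Fm n :=
  sub U M ⊓ (ball R fun p => bex M fun x => bex M fun y => isPair p x y) ⊓ isFun I A M ⊓
  match S with
  | ⟨true, true⟩ => isQuad X M U R I
  | ⟨true, false⟩ => isEmpty R ⊓ isTriple X M U I
  | ⟨false, true⟩ => isEmpty U ⊓ isTriple X M R I
  | ⟨false, false⟩ => isEmpty U ⊓ isEmpty R ⊓ isPair X M I

/-- `a` is the value of the term `t` under the constant assignment `I` and the assignment
`h ∈ ᵐM` of values to the variables. -/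
def termVal (M I m h t a : Fin n) : Fm n :=
  (ex fun i => isVar t i ⊓ coord M m h i a) ⊔ (ex fun c => isConst t c ⊓ app I c a)

/-- `f` enumerates formulas, `g` assigns sets of assignments to them, and `G = g(k)` is, according
to the form of `f(k) = y` and to the values of `g` at arguments below `k`, the set of those
`h ∈ ᵐM` that satisfy `y`. -/
def satStep (M U R I m f g k y G : Fin n) : Fm n :=
  (ex fun t => ex fun s => codeEq y t s ⊓ all fun h => mem h G ⇔ (isTuple M m h ⊓
    ex fun a => termVal M I m h t a ⊓ termVal M I m h s a)) ⊔
  ((ex fun t => codeU y t ⊓ all fun h => mem h G ⇔ (isTuple M m h ⊓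
    ex fun a => termVal M I m h t a ⊓ mem a U)) ⊔
  ((ex fun t => ex fun s => codeR y t s ⊓ all fun h => mem h G ⇔ (isTuple M m h ⊓
    ex fun a => ex fun b => ex fun p =>
      termVal M I m h t a ⊓ termVal M I m h s b ⊓ isPair p a b ⊓ mem p R)) ⊔
  ((bex k fun j => ex fun z => ex fun H => app f j z ⊓ app g j H ⊓ codeNot y z ⊓
    all fun h => mem h G ⇔ (isTuple M m h ⊓ ∼(mem h H))) ⊔
  ((bex k fun j => bex k fun l => ex fun z => ex fun w => ex fun H => ex fun K =>
    app f j z ⊓ app f l w ⊓ app g j H ⊓ app g l K ⊓ codeAnd y z w ⊓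
    all fun h => mem h G ⇔ (mem h H ⊓ mem h K)) ⊔
   (bex k fun j => ex fun z => ex fun i => ex fun H => app f j z ⊓ app g j H ⊓ codeEx y i z ⊓
    all fun h => mem h G ⇔ (isTuple M m h ⊓
      bex M fun x => ex fun h' => isUpdate M m h i x h' ⊓ mem h' H))))))

/-- Satisfaction: `x` is a formula of `L_A` with all its variables among `v_0, …, v_{m-1}`,
`e ∈ ᵐM`, and the structure with data `M, U, R, I` satisfies `x` under the assignment `e`. -/
def Sat (S : Sig) (A M U R I m x e : Fin n) : Fm n :=
  ex fun f => ex fun g => ex fun n' =>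
    isFormSeq S A x f n' ⊓ boundsVars f m ⊓ isFunOn g n' ⊓
    (ball n' fun k => ex fun y => ex fun G =>
      app f k y ⊓ app g k G ⊓ satStep M U R I m f g k y G) ⊓
    (ex fun k => isSucc n' k ⊓ ex fun G => app g k G ⊓ mem e G)

/-- `f` is an elementary embedding of the structure with data `M, U, R, I` into the structure with
data `M', U', R', I'`: a one-to-one function `f : M → M'` such that for every formula `x`, with
variables among `v_0, …, v_{m-1}`, and every `e ∈ ᵐM`, `x` holds at `e` in the former iff it holds
at `e' = f ∘ e` in the latter. If `M` is empty, there are no assignments with `m > 0`; in this case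
elementarity (for sentences such as `∃ v_0 (v_0 ≡ v_0)`) means exactly that `M'` is empty too. -/
def isElemEmb (S : Sig) (A M U R I M' U' R' I' f : Fin n) : Fm n :=
  isFun f M M' ⊓ isInj f ⊓ (isEmpty M ⟹ isEmpty M') ⊓
  all fun m => all fun x => all fun e => all fun e' =>
    (Nat m ⊓ isFormula S A m x ⊓ isTuple M m e ⊓ isTuple M' m e' ⊓
      (ball m fun i => ex fun a => ex fun b =>
        coord M m e i a ⊓ coord M' m e' i b ⊓ app f a b)) ⟹
    (Sat S A M U R I m x e ⇔ Sat S A M' U' R' I' m x e')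

/-- `X` is an `L_A`-structure. -/
def isLStruct (S : Sig) (A X : Fin n) : Fm n :=
  ex fun M => ex fun U => ex fun R => ex fun I => isStruct S A X M U R I

/-- `X` and `Y` are `L_A`-structures and `f : X ≾ Y` for some `f`. -/
def elemEmbeds (S : Sig) (A X Y : Fin n) : Fm n :=
  ex fun M => ex fun U => ex fun R => ex fun I =>
  ex fun M' => ex fun U' => ex fun R' => ex fun I' => ex fun f =>
    isStruct S A X M U R I ⊓ isStruct S A Y M' U' R' I' ⊓
    isElemEmb S A M U R I M' U' R' I' f

end Structures

/-! ### The axioms -/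

/-- Extensionality -/
def axExt : setLang.Sentence :=
  all fun x => all fun y => (all fun z => mem z x ⇔ mem z y) ⟹ eq x y

/-- Empty Set -/
def axEmpty : setLang.Sentence := ex fun x => isEmpty x

/-- Pairing -/
def axPair : setLang.Sentence := all fun x => all fun y => ex fun p => isUPair p x y

/-- Union -/
def axUnion : setLang.Sentence :=
  all fun x => ex fun u => all fun z => mem z u ⇔ bex x fun y => mem z y

/-- Cartesian Product -/
def axProd : setLang.Sentence := all fun x => all fun y => ex fun c => isProd c x y

/-- The instance of Separation for `φ(x, p₁, …, p_k)`, where the variable `0` of `φ` stands for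
`x` and the remaining ones are parameters: for all `p` and `a`, `{x ∈ a : φ(x, p)}` is a set. -/
def axSep {k : ℕ} (φ : setLang.Formula (Fin (k + 1))) : setLang.Sentence :=
  BoundedFormula.alls (n := k) <|
    all fun a => ex fun b => all fun x =>
      mem x b ⇔ (mem x a ⊓ inst φ (Fin.cons x fun i => ((i : Fin (k + 1)) : Fin (k + 3))))

/-- The instance of Induction along `ω` for `φ(x, p₁, …, p_k)`: for all `p`, if every `x` with
`φ(x, p)` is a natural number, then
`[φ(∅) ∧ (∀ x ∈ ω)(φ(x) → φ(x ∪ {x}))] → (∀ x ∈ ω) φ(x)`. -/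
def axInd {k : ℕ} (φ : setLang.Formula (Fin (k + 1))) : setLang.Sentence :=
  BoundedFormula.alls (n := k) <|
    (all fun x => inst φ (Fin.cons x fun i => (i : Fin (k + 1))) ⟹ Nat x) ⟹
    (((all fun z => isEmpty z ⟹ inst φ (Fin.cons z fun i => (i : Fin (k + 1)))) ⊓
      (all fun x => Nat x ⟹ (inst φ (Fin.cons x fun i => (i : Fin (k + 1))) ⟹
        all fun y => isSucc y x ⟹
          inst φ (Fin.cons y fun i => ((i : Fin (k + 1)) : Fin (k + 2)))))) ⟹
    (all fun x => Nat x ⟹ inst φ (Fin.cons x fun i => (i : Fin (k + 1)))))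

/-- Elementary Set Theory: Extensionality, Empty Set, Pairing, Union, Cartesian Product,
`Δ₀`-Separation and Induction along `ω`. -/
def EST : setLang.Theory :=
  {axExt, axEmpty, axPair, axUnion, axProd} ∪
  {σ | ∃ (k : ℕ) (φ : setLang.Formula (Fin (k + 1))), IsDelta0 φ ∧ σ = axSep φ} ∪
  {σ | ∃ (k : ℕ) (φ : setLang.Formula (Fin (k + 1))), σ = axInd φ}

/-- The instance of Vopěnka's Principle for the formula `φ(x)` and for languages with the
predicates specified by `S`: for every set `A`, if `X_φ = {x : φ(x)}` is a proper class and all its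
members are `L_A`-structures, then there are distinct `X, Y ∈ X_φ` with `X ≾ Y`. -/
def axVP (S : Sig) (φ : setLang.Formula (Fin 1)) : setLang.Sentence :=
  all fun A =>
    ((all fun x => ex fun y => (inst φ ![y] ⊓ ∼(mem y x)) ⊔ (∼(inst φ ![y]) ⊓ mem y x)) ⊓
      (all fun X => inst φ ![X] ⟹ isLStruct S A X)) ⟹
    (ex fun X => ex fun Y => ∼(eq X Y) ⊓ inst φ ![X] ⊓ inst φ ![Y] ⊓ elemEmbeds S A X Y)

/-- Vopěnka's Principle, as a scheme. -/
def VP : setLang.Theory :=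
  {σ | ∃ (S : Sig) (φ : setLang.Formula (Fin 1)), σ = axVP S φ}

/-- The class `ω = {x : Nat(x)}` is a set. -/
def omegaIsSet : setLang.Sentence := ex fun w => all fun x => mem x w ⇔ Nat x

/-- Infinity: there is a set that contains `∅` and is closed under `x ↦ x ∪ {x}`. -/
def axInf : setLang.Sentence :=
  ex fun w => (bex w fun z => isEmpty z) ⊓ (ball w fun x => bex w fun y => isSucc y x)

end WeakSet

/-! Suppose that `ω` is not a set. For each natural number `n ≠ 0` let `C_n` be the directed cycle
`0 → 1 → … → n → 0` with an extra loop at `0`, as a structure with one binary relation and no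
constants. A set containing all the `C_n` would yield `ω` by taking unions and applying
`Δ₀`-Separation, so the `C_n` form a proper class (`exists_omega_of_cycles_set`). VP then gives two
distinct cycles and an elementary embedding of one into the other.

But the cycles are rigid (`IsCycleRel.rigid`). The loop forces `0 ↦ 0`; by induction `x + 1` must go
to a successor of `x` in the target, and by injectivity that is not `0`, so `x + 1 ↦ x + 1`; finally
the edge from `n` back to `0` shows that the two cycles have the same length. This is a
contradiction.

Of elementarity, only injectivity and preservation of the atomic formula `R(v₀, v₁)` are needed. The
technical burden is to evaluate the internal satisfaction predicate at the code of this formula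
(`realize_Sat_relCode`) using only the axioms of EST, where the required sets come from Pairing,
Union, products and `Δ₀`-Separation. -/

namespace WeakSet

universe u

/-! ### Semantics of the elementary notions -/

section Semantics

variable {V : Type u} [setLang.Structure V] {n : ℕ} {v : Empty → V} {xs : Fin n → V}

/-- Membership in a structure for the language of set theory. -/
def E (x y : V) : Prop := Structure.RelMap (L := setLang) (n := 2) SetRel.mem ![x, y]

infix:50 " ε " => E

@[simp] theorem realize_mem {x y : Fin n} : (mem x y).Realize v xs ↔ xs x ε xs y :=
  BoundedFormula.realize_rel₂

@[simp] theorem realize_eq {x y : Fin n} : (eq x y).Realize v xs ↔ xs x = xs y := by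
  simp [eq]

@[simp] theorem realize_all {φ : Fin (n + 1) → Fm (n + 1)} :
    (all φ).Realize v xs ↔ ∀ a, (φ (Fin.last n)).Realize v (Fin.snoc xs a) := Iff.rfl

@[simp] theorem realize_ex {φ : Fin (n + 1) → Fm (n + 1)} :
    (ex φ).Realize v xs ↔ ∃ a, (φ (Fin.last n)).Realize v (Fin.snoc xs a) := by
  simp [ex]

@[simp] theorem realize_ball {x : Fin n} {φ : Fin (n + 1) → Fm (n + 1)} :
    (ball x φ).Realize v xs ↔ ∀ a, a ε xs x → (φ (Fin.last n)).Realize v (Fin.snoc xs a) := by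
  simp [ball]

@[simp] theorem realize_bex {x : Fin n} {φ : Fin (n + 1) → Fm (n + 1)} :
    (bex x φ).Realize v xs ↔ ∃ a, a ε xs x ∧ (φ (Fin.last n)).Realize v (Fin.snoc xs a) := by
  simp [bex]

@[simp] theorem realize_sub {x y : Fin n} :
    (sub x y).Realize v xs ↔ ∀ z, z ε xs x → z ε xs y := by
  simp [sub]

@[simp] theorem realize_inst {k : ℕ} {φ : setLang.Formula (Fin k)} {x : Fin k → Fin n} :
    (inst φ x).Realize v xs ↔ φ.Realize (xs ∘ x) := by
  rw [inst, BoundedFormula.realize_relabel, Formula.Realize]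
  exact iff_of_eq (congrArg₂ _ rfl (Subsingleton.elim _ _))

/-- A formula in a context of length `k`, as a formula whose free variables are indexed by
`Fin k`. -/
def Fm.toFormula {k : ℕ} (φ : Fm k) : setLang.Formula (Fin k) :=
  (BoundedFormula.toFormula φ).relabel (Sum.elim Empty.elim id)

@[simp] theorem Fm.realize_toFormula {k : ℕ} {φ : Fm k} {x : Fin k → V} :
    φ.toFormula.Realize x ↔ φ.Realize default x := by
  rw [Fm.toFormula, Formula.realize_relabel, BoundedFormula.realize_toFormula]
  exact iff_of_eq (congrArg₂ _ (Subsingleton.elim _ _) rfl)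

end Semantics

/-! ### `Δ₀` formulas -/

section Delta0

variable {α : Type} {n : ℕ}

/-- Bounded universal quantification. -/
def dball (t : α ⊕ Fin n) (φ : α ⊕ Fin (n + 1) → setLang.BoundedFormula α (n + 1)) :
    setLang.BoundedFormula α n :=
  BoundedFormula.all
        (Relations.boundedFormula₂ (SetRel.mem : setLang.Relations 2)
          (Term.var (Sum.inr (Fin.last n)) : setLang.Term (α ⊕ Fin (n + 1)))
          (Term.var (Sum.map id Fin.castSucc t)) ⟹ φ (Sum.inr (Fin.last n)))

/-- Bounded existential quantification. -/
def dbex (t : α ⊕ Fin n) (φ : α ⊕ Fin (n + 1) → setLang.BoundedFormula α (n + 1)) :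
    setLang.BoundedFormula α n := ∼(dball t fun y => ∼(φ y))

/-- `s ∈ t` -/
def dmem (s t : α ⊕ Fin n) : setLang.BoundedFormula α n :=
  Relations.boundedFormula₂ (SetRel.mem : setLang.Relations 2)
    (Term.var s : setLang.Term (α ⊕ Fin n)) (Term.var t)

/-- `s = t` -/
def deq (s t : α ⊕ Fin n) : setLang.BoundedFormula α n :=
  Term.bdEqual (Term.var s : setLang.Term (α ⊕ Fin n)) (Term.var t)

theorem IsDelta0.dmem (s t : α ⊕ Fin n) : IsDelta0 (dmem s t) := .mem s t

theorem IsDelta0.deq (s t : α ⊕ Fin n) : IsDelta0 (deq s t) := .eq s t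

/-- The connectives `∼`, `⊓`, `⊔` unfold definitionally to `⟹` and `⊥`, the only ones that
`IsDelta0` has constructors for. -/
theorem IsDelta0.not {φ : setLang.BoundedFormula α n} (h : IsDelta0 φ) : IsDelta0 (∼φ) :=
  .imp h .falsum

theorem IsDelta0.and {φ ψ : setLang.BoundedFormula α n} (h : IsDelta0 φ) (h' : IsDelta0 ψ) :
    IsDelta0 (φ ⊓ ψ) := (h.imp h'.not).not

theorem IsDelta0.or {φ ψ : setLang.BoundedFormula α n} (h : IsDelta0 φ) (h' : IsDelta0 ψ) :
    IsDelta0 (φ ⊔ ψ) := h.not.imp h'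

theorem IsDelta0.dball {t : α ⊕ Fin n} {φ : α ⊕ Fin (n + 1) → setLang.BoundedFormula α (n + 1)}
    (h : ∀ y, IsDelta0 (φ y)) : IsDelta0 (dball t φ) := .ball t (h _)

theorem IsDelta0.dbex {t : α ⊕ Fin n} {φ : α ⊕ Fin (n + 1) → setLang.BoundedFormula α (n + 1)}
    (h : ∀ y, IsDelta0 (φ y)) : IsDelta0 (dbex t φ) := (IsDelta0.dball fun y => (h y).not).not

/-- A variable in a context of length `n` is also a variable in the context of length `n + 1`. -/
abbrev up (t : α ⊕ Fin n) : α ⊕ Fin (n + 1) := Sum.map id Fin.castSucc t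

/-- `x = ∅`, as a `Δ₀` formula. -/
def dEmpty (x : α ⊕ Fin n) : setLang.BoundedFormula α n := dball x fun _ => ⊥

/-- `p = {a, b}`, as a `Δ₀` formula. -/
def dUPair (p a b : α ⊕ Fin n) : setLang.BoundedFormula α n :=
  dmem a p ⊓ dmem b p ⊓ dball p fun z => deq z (up a) ⊔ deq z (up b)

/-- `p = ⟨a, b⟩`, as a `Δ₀` formula. -/
def dPair (p a b : α ⊕ Fin n) : setLang.BoundedFormula α n :=
  (dbex p fun s => dUPair s (up a) (up a)) ⊓ (dbex p fun s => dUPair s (up a) (up b)) ⊓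
  dball p fun s => dUPair s (up a) (up a) ⊔ dUPair s (up a) (up b)

/-- `y = x ∪ {x}`, as a `Δ₀` formula. -/
def dSucc (y x : α ⊕ Fin n) : setLang.BoundedFormula α n :=
  dmem x y ⊓ (dball x fun z => dmem z (up y)) ⊓ dball y fun z => dmem z (up x) ⊔ deq z (up x)

/-- `Nat(x)`, as a `Δ₀` formula. -/
def dNat (x : α ⊕ Fin n) : setLang.BoundedFormula α n :=
  (dball x fun y => dball y fun z => dmem z (up (up x))) ⊓
  (dball x fun y => dball (up x) fun z => dmem (up y) z ⊔ (deq (up y) z ⊔ dmem z (up y))) ⊓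
  -- The range `y ∈ x ∨ y = x` is not a bounded quantifier; it is split into the case `y ∈ x` and,
  -- in the last conjunct, the case `y = x`.
  (dball x fun y => dEmpty y ⊔ dbex y fun z => dSucc (up y) z) ⊓
  (dEmpty x ⊔ dbex x fun z => dSucc (up x) z)

/-- `IsDelta0` is a syntactic condition, and `isPair`, `isSucc` and `Nat` fail it because of their
unbounded quantifiers. The bounded variants are what Separation accepts; they have the same meaning
in models of EST. -/
theorem isDelta0_dEmpty (x : α ⊕ Fin n) : IsDelta0 (dEmpty x) := .dball fun _ => .falsum

theorem isDelta0_dUPair (p a b : α ⊕ Fin n) : IsDelta0 (dUPair p a b) :=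
  ((IsDelta0.dmem _ _).and (.dmem _ _)).and (.dball fun _ => (IsDelta0.deq _ _).or (.deq _ _))

theorem isDelta0_dPair (p a b : α ⊕ Fin n) : IsDelta0 (dPair p a b) :=
  ((IsDelta0.dbex fun _ => isDelta0_dUPair _ _ _).and (.dbex fun _ => isDelta0_dUPair _ _ _)).and
    (.dball fun _ => (isDelta0_dUPair _ _ _).or (isDelta0_dUPair _ _ _))

theorem isDelta0_dSucc (y x : α ⊕ Fin n) : IsDelta0 (dSucc y x) :=
  ((IsDelta0.dmem _ _).and (.dball fun _ => .dmem _ _)).and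
    (.dball fun _ => (IsDelta0.dmem _ _).or (.deq _ _))

theorem isDelta0_dNat (x : α ⊕ Fin n) : IsDelta0 (dNat x) :=
  (((IsDelta0.dball fun _ => .dball fun _ => .dmem _ _).and
    (.dball fun _ => .dball fun _ => (IsDelta0.dmem _ _).or ((IsDelta0.deq _ _).or
      (.dmem _ _)))).and
    (.dball fun _ => (isDelta0_dEmpty _).or (.dbex fun _ => isDelta0_dSucc _ _))).and
    ((isDelta0_dEmpty _).or (.dbex fun _ => isDelta0_dSucc _ _))

@[simp] theorem elim_snoc_up {V : Type u} {v : α → V} {xs : Fin n → V}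
    {t : α ⊕ Fin n} {a : V} :
    Sum.elim v (Fin.snoc xs a : Fin (n + 1) → V) (up t) = Sum.elim v xs t := by
  cases t <;> simp [up]

variable {V : Type u} [setLang.Structure V] {v : α → V} {xs : Fin n → V}

@[simp] theorem realize_dmem {s t : α ⊕ Fin n} :
    (dmem s t).Realize v xs ↔ Sum.elim v xs s ε Sum.elim v xs t :=
  BoundedFormula.realize_rel₂

@[simp] theorem realize_deq {s t : α ⊕ Fin n} :
    (deq s t).Realize v xs ↔ Sum.elim v xs s = Sum.elim v xs t := by
  simp [deq]

@[simp] theorem realize_dball {t : α ⊕ Fin n}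
    {φ : α ⊕ Fin (n + 1) → setLang.BoundedFormula α (n + 1)} :
    (dball t φ).Realize v xs ↔ ∀ a, a ε Sum.elim v xs t →
      (φ (Sum.inr (Fin.last n))).Realize v (Fin.snoc xs a) := by
  change (∀ a, (dmem (Sum.inr (Fin.last n)) (up t)).Realize v (Fin.snoc xs a) → _) ↔ _
  simp only [realize_dmem, elim_snoc_up, Sum.elim_inr, Fin.snoc_last]

@[simp] theorem realize_dbex {t : α ⊕ Fin n}
    {φ : α ⊕ Fin (n + 1) → setLang.BoundedFormula α (n + 1)} :
    (dbex t φ).Realize v xs ↔ ∃ a, a ε Sum.elim v xs t ∧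
      (φ (Sum.inr (Fin.last n))).Realize v (Fin.snoc xs a) := by
  simp [dbex]

end Delta0

/-! ### Set operations in models of `EST` -/

section Operations

variable {V : Type u} [setLang.Structure V] [V ⊨ EST]

theorem realize_of_mem_EST {σ : setLang.Sentence} (h : σ ∈ EST) : V ⊨ σ :=
  Theory.realize_sentence_of_mem EST h

theorem ext {x y : V} (h : ∀ z, z ε x ↔ z ε y) : x = y := by
  have := realize_of_mem_EST (V := V) (σ := axExt) (by simp [EST])
  simp only [axExt, Sentence.Realize, Formula.Realize, realize_all, BoundedFormula.realize_imp,
    BoundedFormula.realize_iff, realize_mem, realize_eq, Fin.snoc_castSucc, Fin.snoc_last] at this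
  exact this x y h

theorem exists_empty : ∃ x : V, ∀ z, ¬ z ε x := by
  have := realize_of_mem_EST (V := V) (σ := axEmpty) (by simp [EST])
  simpa only [axEmpty, isEmpty, Sentence.Realize, Formula.Realize, realize_all, realize_ex,
    BoundedFormula.realize_not, realize_mem, Fin.snoc_castSucc, Fin.snoc_last] using this

theorem exists_upair (x y : V) : ∃ p : V, ∀ z, z ε p ↔ z = x ∨ z = y := by
  have := realize_of_mem_EST (V := V) (σ := axPair) (by simp [EST])
  simp only [axPair, isUPair, Sentence.Realize, Formula.Realize, realize_all, realize_ex,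
    BoundedFormula.realize_iff, BoundedFormula.realize_sup, realize_mem, realize_eq,
    Fin.snoc_castSucc, Fin.snoc_last] at this
  exact this x y

theorem exists_union (x : V) : ∃ u : V, ∀ z, z ε u ↔ ∃ y, y ε x ∧ z ε y := by
  have := realize_of_mem_EST (V := V) (σ := axUnion) (by simp [EST])
  simp only [axUnion, Sentence.Realize, Formula.Realize, realize_all, realize_ex, realize_bex,
    BoundedFormula.realize_iff, realize_mem, Fin.snoc_castSucc, Fin.snoc_last] at this
  exact this x

/-- The empty set. -/
noncomputable def emp : V := Classical.choose (exists_empty (V := V))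

/-- The unordered pair. -/
noncomputable def upair (x y : V) : V := Classical.choose (exists_upair x y)

/-- The union of a set. -/
noncomputable def sUnion (x : V) : V := Classical.choose (exists_union x)

/-- The successor `x ∪ {x}`. -/
noncomputable def succ (x : V) : V := sUnion (upair x (upair x x))

/-- The ordered pair. -/
noncomputable def pair (x y : V) : V := upair (upair x x) (upair x y)

@[simp] theorem not_mem_emp (z : V) : ¬ z ε emp := Classical.choose_spec (exists_empty (V := V)) z

@[simp] theorem mem_upair {x y z : V} : z ε upair x y ↔ z = x ∨ z = y :=
  Classical.choose_spec (exists_upair x y) z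

@[simp] theorem mem_sUnion {x z : V} : z ε sUnion x ↔ ∃ y, y ε x ∧ z ε y :=
  Classical.choose_spec (exists_union x) z

@[simp] theorem mem_succ {x z : V} : z ε succ x ↔ z ε x ∨ z = x := by
  simp [succ]

theorem eq_emp_iff {x : V} : x = emp ↔ ∀ z, ¬ z ε x :=
  ⟨fun h => by simp [h], fun h => ext fun z => by simp [h z]⟩

theorem eq_upair_iff {p x y : V} : p = upair x y ↔ ∀ z, z ε p ↔ z = x ∨ z = y :=
  ⟨fun h => by simp [h], fun h => ext fun z => by simp [h z]⟩

theorem eq_succ_iff {x y : V} : y = succ x ↔ ∀ z, z ε y ↔ z ε x ∨ z = x :=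
  ⟨fun h => by simp [h], fun h => ext fun z => by simp [h z]⟩

theorem upair_eq_upair {a b c d : V} :
    upair a b = upair c d ↔ a = c ∧ b = d ∨ a = d ∧ b = c := by
  constructor
  · intro h
    have h1 : a ε upair c d := h ▸ by simp
    have h2 : b ε upair c d := h ▸ by simp
    have h3 : c ε upair a b := h ▸ by simp
    have h4 : d ε upair a b := h ▸ by simp
    simp only [mem_upair] at h1 h2 h3 h4
    grind
  · rintro (⟨rfl, rfl⟩ | ⟨rfl, rfl⟩)
    · rfl
    · exact ext fun z => by simp [or_comm]

@[simp] theorem pair_inj {a b c d : V} : pair a b = pair c d ↔ a = c ∧ b = d := by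
  simp only [pair, upair_eq_upair]
  grind

theorem singleton_mem_pair (a b : V) : upair a a ε pair a b := mem_upair.2 (.inl rfl)

theorem pair_ne_emp (a b : V) : pair a b ≠ emp := fun h =>
  not_mem_emp (upair a a) (h ▸ by simp [pair])

theorem emp_not_mem_pair (a b : V) : ¬ emp ε pair a b := by
  simp only [pair, mem_upair, not_or]
  constructor <;> intro h <;> exact not_mem_emp a (h ▸ by simp)

theorem exists_prod (x y : V) :
    ∃ c : V, ∀ z, z ε c ↔ ∃ a, a ε x ∧ ∃ b, b ε y ∧ z = pair a b := by
  have := realize_of_mem_EST (V := V) (σ := axProd) (by simp [EST])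
  simp only [axProd, isProd, isPair, isUPair, Sentence.Realize, Formula.Realize, realize_all,
    realize_ex, realize_bex, BoundedFormula.realize_iff, BoundedFormula.realize_inf,
    BoundedFormula.realize_sup, realize_mem, realize_eq,
    Fin.snoc_castSucc, Fin.snoc_last, ← eq_upair_iff] at this
  simpa [pair] using this x y

/-- The Cartesian product. -/
noncomputable def prod (x y : V) : V := Classical.choose (exists_prod x y)

@[simp] theorem mem_prod {x y z : V} :
    z ε prod x y ↔ ∃ a, a ε x ∧ ∃ b, b ε y ∧ z = pair a b :=
  Classical.choose_spec (exists_prod x y) z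

theorem exists_sep {k : ℕ} (φ : setLang.Formula (Fin (k + 1))) (hφ : IsDelta0 φ) (p : Fin k → V)
    (a : V) : ∃ b : V, ∀ x, x ε b ↔ x ε a ∧ φ.Realize (Fin.cons x p) := by
  have := realize_of_mem_EST (V := V) (σ := axSep φ)
    (by simp only [EST, Set.mem_union, Set.mem_ofPred_eq]; exact .inl (.inr ⟨k, φ, hφ, rfl⟩))
  simp only [axSep, Sentence.Realize, BoundedFormula.realize_alls, realize_all, realize_ex,
    BoundedFormula.realize_iff, BoundedFormula.realize_inf, realize_mem, realize_inst,
    Fin.snoc_castSucc, Fin.snoc_last] at this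
  obtain ⟨b, hb⟩ := this p a
  refine ⟨b, fun x => (hb x).trans (and_congr_right fun _ => iff_of_eq (congrArg _ ?_))⟩
  funext i
  refine Fin.cases ?_ (fun i => ?_) i <;> simp

/-! ### The elementary notions, interpreted in models of `EST` -/

/-- `x` is a natural number. -/
def IsNat (x : V) : Prop :=
  ((∀ y, y ε x → ∀ z, z ε y → z ε x) ∧ ∀ y, y ε x → ∀ z, z ε x → y ε z ∨ y = z ∨ z ε y) ∧
    ∀ y, y ε x ∨ y = x → y = emp ∨ ∃ z, z ε y ∧ y = succ z

/-- The numeral `k`. -/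
noncomputable def num : ℕ → V
  | 0 => emp
  | k + 1 => succ (num k)

/-- `f` is a function with domain `d`. -/
def IsFunOn (f d : V) : Prop :=
  (∀ p, p ε f → ∃ x, x ε d ∧ ∃ y, p = pair x y) ∧
    ∀ x, x ε d → ∃ y, pair x y ε f ∧ ∀ z, pair x z ε f → z = y

variable {n : ℕ} {v : Empty → V} {xs : Fin n → V}

@[simp] theorem realize_isEmpty {x : Fin n} : (isEmpty x).Realize v xs ↔ xs x = emp := by
  simp [isEmpty, eq_emp_iff]

@[simp] theorem realize_isUPair {p a b : Fin n} :
    (isUPair p a b).Realize v xs ↔ xs p = upair (xs a) (xs b) := by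
  simp [isUPair, eq_upair_iff]

@[simp] theorem realize_isPair {p a b : Fin n} :
    (isPair p a b).Realize v xs ↔ xs p = pair (xs a) (xs b) := by
  simp [isPair, pair]

@[simp] theorem realize_isTriple {p a b c : Fin n} :
    (isTriple p a b c).Realize v xs ↔ xs p = pair (pair (xs a) (xs b)) (xs c) := by
  simp [isTriple]

@[simp] theorem realize_isSucc {x y : Fin n} :
    (isSucc y x).Realize v xs ↔ xs y = succ (xs x) := by
  simp [isSucc, eq_succ_iff]

@[simp] theorem realize_Nat {x : Fin n} : (Nat x).Realize v xs ↔ IsNat (xs x) := by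
  simp [Nat, Ord, Tr, Succ, IsNat]

@[simp] theorem realize_isNum {k : ℕ} {x : Fin n} :
    (isNum k x).Realize v xs ↔ xs x = num k := by
  induction k generalizing n with
  | zero => simp [isNum, num]
  | succ k ih => simp [isNum, num, ih]

@[simp] theorem realize_app {f x y : Fin n} :
    (app f x y).Realize v xs ↔ pair (xs x) (xs y) ε xs f := by
  simp [app]

@[simp] theorem realize_isFunOn {f d : Fin n} :
    (isFunOn f d).Realize v xs ↔ IsFunOn (xs f) (xs d) := by
  simp [isFunOn, IsFunOn]

@[simp] theorem realize_isFun {f a b : Fin n} :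
    (isFun f a b).Realize v xs ↔
      IsFunOn (xs f) (xs a) ∧ ∀ x, x ε xs a → ∀ y, pair x y ε xs f → y ε xs b := by
  simp [isFun]

@[simp] theorem realize_isInj {f : Fin n} :
    (isInj f).Realize v xs ↔ ∀ x y z, pair x z ε xs f → pair y z ε xs f → x = y := by
  simp [isInj]

/-! ### Interpretation of `Δ₀` formulas -/

section Delta0

variable {α : Type} {v : α → V}

@[simp] theorem realize_dEmpty {x : α ⊕ Fin n} :
    (dEmpty x).Realize v xs ↔ Sum.elim v xs x = emp := by
  simp [dEmpty, eq_emp_iff]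

@[simp] theorem realize_dUPair {p a b : α ⊕ Fin n} :
    (dUPair p a b).Realize v xs ↔
      Sum.elim v xs p = upair (Sum.elim v xs a) (Sum.elim v xs b) := by
  simp only [dUPair, BoundedFormula.realize_inf, realize_dmem, realize_dball,
    BoundedFormula.realize_sup, realize_deq, elim_snoc_up, Sum.elim_inr, Fin.snoc_last,
    eq_upair_iff]
  grind

@[simp] theorem realize_dPair {p a b : α ⊕ Fin n} :
    (dPair p a b).Realize v xs ↔
      Sum.elim v xs p = pair (Sum.elim v xs a) (Sum.elim v xs b) := by
  simp only [dPair, BoundedFormula.realize_inf, realize_dball, realize_dbex,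
    BoundedFormula.realize_sup, realize_dUPair, elim_snoc_up, Sum.elim_inr, Fin.snoc_last,
    pair, eq_upair_iff (p := Sum.elim v xs p)]
  grind

@[simp] theorem realize_dSucc {y x : α ⊕ Fin n} :
    (dSucc y x).Realize v xs ↔ Sum.elim v xs y = succ (Sum.elim v xs x) := by
  simp only [dSucc, BoundedFormula.realize_inf, realize_dmem, realize_dball,
    BoundedFormula.realize_sup, realize_deq, elim_snoc_up, Sum.elim_inr, Fin.snoc_last,
    eq_succ_iff]
  grind

@[simp] theorem realize_dNat {x : α ⊕ Fin n} :
    (dNat x).Realize v xs ↔ IsNat (Sum.elim v xs x) := by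
  simp only [dNat, BoundedFormula.realize_inf, realize_dmem, realize_dball, realize_dbex,
    BoundedFormula.realize_sup, realize_deq, elim_snoc_up, Sum.elim_inr, Fin.snoc_last,
    realize_dSucc, realize_dEmpty, IsNat, or_imp, forall_and, forall_eq, and_assoc]

end Delta0

/-! ### Natural numbers -/

theorem isNat_emp : IsNat (emp : V) := by
  simp [IsNat]

theorem isNat_succ {x : V} (h : IsNat x) : IsNat (succ x) := by
  obtain ⟨⟨h1, h2⟩, h3⟩ := h
  simp only [IsNat, mem_succ]
  refine ⟨⟨?_, ?_⟩, ?_⟩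
  · rintro y (hy | rfl) z hz
    · exact .inl (h1 y hy z hz)
    · exact .inl hz
  · rintro y (hy | rfl) z (hz | rfl)
    · exact h2 y hy z hz
    · exact .inl hy
    · exact .inr (.inr hz)
    · exact .inr (.inl rfl)
  · rintro y (hy | rfl)
    · exact h3 y hy
    · exact .inr ⟨x, by simp⟩

theorem nat_induction {k : ℕ} (φ : Fm (k + 1)) (p : Fin k → V)
    (zero : φ.Realize default (Fin.cons emp p : Fin (k + 1) → V))
    (step : ∀ x : V, IsNat x → φ.Realize default (Fin.cons x p : Fin (k + 1) → V) →
      φ.Realize default (Fin.cons (succ x) p : Fin (k + 1) → V))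
    {x : V} (hx : IsNat x) : φ.Realize default (Fin.cons x p : Fin (k + 1) → V) := by
  -- The induction axiom demands a formula that implies `Nat`; the added conjunct `Nat 0` removes
  -- this restriction on `φ`.
  have := realize_of_mem_EST (V := V) (σ := axInd (Nat 0 ⊓ φ).toFormula)
    (by simp only [EST, Set.mem_union, Set.mem_ofPred_eq]; exact .inr ⟨k, _, rfl⟩)
  have e (m : ℕ) (xs : Fin m → V) (y : Fin m) (q : Fin k → Fin m) :
      xs ∘ (Fin.cons y q : Fin (k + 1) → Fin m) = Fin.cons (xs y) fun i => xs (q i) := by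
    funext i
    refine Fin.cases ?_ (fun i => ?_) i <;> simp
  simp only [axInd, Sentence.Realize, BoundedFormula.realize_alls, realize_all,
    BoundedFormula.realize_imp, BoundedFormula.realize_inf, realize_inst, realize_Nat,
    realize_isEmpty, realize_isSucc, Fm.realize_toFormula, e,
    Fin.snoc_castSucc, Fin.snoc_last, Fin.cons_zero] at this
  refine (this p (fun x h => h.1) ⟨?_, ?_⟩ x hx).2
  · rintro z rfl
    exact ⟨isNat_emp, zero⟩
  · rintro x hx h y rfl
    exact ⟨isNat_succ hx, step x hx h.2⟩

/-- EST has no Foundation, so this needs induction: either way of having `succ x ε succ x` leads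
back to `x ε x`, by transitivity of `x` or by `x ε succ x`. -/
theorem IsNat.not_mem_self {x : V} (hx : IsNat x) : ¬ x ε x := by
  have := nat_induction (V := V) (k := 0) (∼(mem 0 0)) ![] (by simp) (fun x hx h => ?_) hx
  · simpa using this
  · simp only [BoundedFormula.realize_not, realize_mem, Fin.cons_zero, mem_succ] at h ⊢
    rintro (h' | h')
    · exact h (hx.1.1 _ h' _ (by simp))
    · have : x ε succ x := by simp
      rw [h'] at this
      exact h this

theorem IsNat.of_mem {x y : V} (hx : IsNat x) (hy : y ε x) : IsNat y := by
  have := nat_induction (V := V) (k := 0) (ball 0 fun y => Nat y) ![] (by simp)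
    (fun x hx h => ?_) hx
  · simp only [realize_ball, realize_Nat, Fin.cons_zero, Fin.snoc_last] at this
    exact this y hy
  · simp only [realize_ball, realize_Nat, Fin.cons_zero, Fin.snoc_last, mem_succ] at h ⊢
    rintro y (hy | rfl)
    · exact h y hy
    · exact hx

theorem IsNat.emp_mem_succ {x : V} (hx : IsNat x) : emp ε succ x := by
  -- The language has no terms for `succ` and `emp`, so the induction formula has to quantify over
  -- their values.
  have := nat_induction (V := V) (k := 0) (ex fun s => isSucc s 0 ⊓ ex fun z => isEmpty z ⊓ mem z s)
    ![] (by simp) (fun x hx h => ?_) hx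
  · simpa using this
  · have h : emp ε succ x := by simpa using h
    have : emp ε succ (succ x) := mem_succ.2 (.inl h)
    simpa using this

theorem isNat_num (k : ℕ) : IsNat (num k : V) := by
  induction k with
  | zero => exact isNat_emp
  | succ k ih => exact isNat_succ ih

theorem num_mem_num {i j : ℕ} (h : i < j) : (num i : V) ε num j := by
  induction h with
  | refl => simp [num]
  | step _ ih => exact mem_succ.2 (.inl ih)

@[simp] theorem num_inj {i j : ℕ} : (num i : V) = num j ↔ i = j := by
  refine ⟨fun h => ?_, fun h => h ▸ rfl⟩
  rcases lt_trichotomy i j with hl | hl | hl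
  · have := num_mem_num (V := V) hl
    exact absurd (h ▸ this) (isNat_num (V := V) j).not_mem_self
  · exact hl
  · have := num_mem_num (V := V) hl
    exact absurd (h ▸ this) (isNat_num (V := V) i).not_mem_self

-- A nonzero numeral contains `∅` and a Kuratowski pair does not. This lets `simp` tell codes of the
-- form `⟨tag, t⟩` from codes of the form `⟨⟨tag, t⟩, s⟩`.
@[simp] theorem pair_ne_num (a b : V) (k : ℕ) : pair a b ≠ num k := by
  intro h
  cases k with
  | zero => exact pair_ne_emp a b h
  | succ k => exact emp_not_mem_pair a b (h ▸ num_mem_num (i := 0) k.succ_pos)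

@[simp] theorem num_ne_pair (a b : V) (k : ℕ) : num k ≠ pair a b := (pair_ne_num a b k).symm

theorem succ_ne_emp (x : V) : succ x ≠ emp := fun h => not_mem_emp x (h ▸ by simp)

end Operations

/-! ### Internal satisfaction of the formula `R(v₀, v₁)` -/

section Satisfaction

variable {V : Type u} [setLang.Structure V] [V ⊨ EST]

theorem IsFunOn.unique {f d x y z : V} (h : IsFunOn f d) (hy : pair x y ε f)
    (hz : pair x z ε f) : y = z := by
  obtain ⟨x', hx', y', e⟩ := h.1 _ hy
  obtain ⟨rfl, rfl⟩ := pair_inj.1 e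
  obtain ⟨w, -, hw⟩ := h.2 _ hx'
  rw [hw _ hy, hw _ hz]

/-- The function with domain `{∅}` and value `x`. -/
noncomputable def single (x : V) : V := upair (pair emp x) (pair emp x)

@[simp] theorem mem_single {x p : V} : p ε single x ↔ p = pair emp x := by
  simp [single]

/-- An atomic formula has a formation sequence of length `1`, so functions of this shape serve both
as formation sequence and as the sequence of satisfaction sets. -/
theorem isFunOn_single (x : V) : IsFunOn (single x) (num 1) := by
  simp [IsFunOn, num]

/-! ### Tuples -/

/-- Step `k` of the construction `s` of a tuple appends `⟨k, x⟩`. -/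
def TupleStep (s k x : V) : Prop :=
  ∃ y, pair k y ε s ∧ pair (succ k) (pair y (pair k x)) ε s

/-- `s` is the sequence of the initial parts of the tuple `h ∈ ᵐM`. -/
def IsTupleSeq (M m h s : V) : Prop :=
  IsFunOn s (succ m) ∧ pair emp emp ε s ∧ pair m h ε s ∧ ∀ k, k ε m → ∃ x, x ε M ∧ TupleStep s k x

/-- `h ∈ ᵐM` -/
def IsTuple (M m h : V) : Prop := ∃ s, IsTupleSeq M m h s

/-- `h ∈ ᵐM`, `i < m` and `h(i) = x`. -/
def Coord (M m h i x : V) : Prop := i ε m ∧ ∃ s, IsTupleSeq M m h s ∧ TupleStep s i x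

/-- The pair `⟨a, b⟩` as an element of `²M`. -/
noncomputable def tup (a b : V) : V := pair (pair emp (pair (num 0) a)) (pair (num 1) b)

/-- The three entries are the stages `0, 1, 2` in the construction of a pair; as there are only
finitely many, Pairing and Union suffice. -/
theorem exists_tupleSeq (a b : V) : ∃ s : V, ∀ z, z ε s ↔
    z = pair (num 0) emp ∨ z = pair (num 1) (pair emp (pair (num 0) a)) ∨
      z = pair (num 2) (tup a b) :=
  ⟨sUnion (upair (upair (pair (num 0) emp) (pair (num 1) (pair emp (pair (num 0) a))))
    (upair (pair (num 2) (tup a b)) (pair (num 2) (tup a b)))), fun z => by simp [or_assoc]⟩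

theorem mem_num_two {x : V} : x ε num 2 ↔ x = num 0 ∨ x = num 1 := by
  simp [num]

theorem mem_num_three {x : V} : x ε num 3 ↔ x = num 0 ∨ x = num 1 ∨ x = num 2 := by
  simp [num, or_assoc]

theorem isTupleSeq_two_of {M a b s : V} (ha : a ε M) (hb : b ε M)
    (hs : ∀ z, z ε s ↔ z = pair (num 0) emp ∨ z = pair (num 1) (pair emp (pair (num 0) a)) ∨
      z = pair (num 2) (tup a b)) : IsTupleSeq M (num 2) (tup a b) s := by
  refine ⟨⟨?_, ?_⟩, ?_, ?_, ?_⟩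
  · intro p hp
    rcases (hs p).1 hp with rfl | rfl | rfl
    · exact ⟨num 0, num_mem_num (j := 3) (by simp), _, rfl⟩
    · exact ⟨num 1, num_mem_num (j := 3) (by simp), _, rfl⟩
    · exact ⟨num 2, num_mem_num (j := 3) (by simp), _, rfl⟩
  · intro x hx
    rcases mem_num_three.1 hx with rfl | rfl | rfl <;> simp [hs]
  · exact (hs _).2 (.inl rfl)
  · exact (hs _).2 (.inr (.inr rfl))
  · intro k hk
    rcases mem_num_two.1 hk with rfl | rfl
    · exact ⟨a, ha, emp, (hs _).2 (.inl rfl), (hs _).2 (.inr (.inl rfl))⟩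
    · exact ⟨b, hb, _, (hs _).2 (.inr (.inl rfl)), (hs _).2 (.inr (.inr rfl))⟩

/-- The value at `0` is `∅` and each step determines the next value, so functionality of `s` fixes
the whole sequence and, by injectivity of pairing, its coordinates. -/
theorem IsTupleSeq.exists_two {M h s : V} (H : IsTupleSeq M (num 2) h s) :
    ∃ a b, a ε M ∧ b ε M ∧ h = tup a b ∧
      (∀ x, TupleStep s (num 0) x → x = a) ∧ ∀ x, TupleStep s (num 1) x → x = b := by
  obtain ⟨hf, h0, h2, hk⟩ := H
  obtain ⟨a, ha, y, hy, hy'⟩ := hk (num 0) (mem_num_two.2 (.inl rfl))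
  obtain ⟨b, hb, z, hz, hz'⟩ := hk (num 1) (mem_num_two.2 (.inr rfl))
  obtain rfl : y = emp := hf.unique hy h0
  obtain rfl : z = pair emp (pair (num 0) a) := hf.unique hz hy'
  refine ⟨a, b, ha, hb, hf.unique h2 hz', ?_, ?_⟩
  · rintro x ⟨w, -, hw'⟩
    have := hf.unique hw' hy'
    simp only [pair_inj] at this
    exact this.2.2
  · rintro x ⟨w, -, hw'⟩
    have := hf.unique hw' hz'
    simp only [pair_inj] at this
    exact this.2.2

theorem isTuple_two {M h : V} : IsTuple M (num 2) h ↔ ∃ a b, a ε M ∧ b ε M ∧ h = tup a b := by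
  constructor
  · rintro ⟨s, hs⟩
    obtain ⟨a, b, ha, hb, e, -⟩ := hs.exists_two
    exact ⟨a, b, ha, hb, e⟩
  · rintro ⟨a, b, ha, hb, rfl⟩
    obtain ⟨s, hs⟩ := exists_tupleSeq a b
    exact ⟨s, isTupleSeq_two_of ha hb hs⟩

theorem tup_inj {a b c d : V} : tup a b = tup c d ↔ a = c ∧ b = d := by
  simp [tup]

theorem coord_zero {M a b x : V} (ha : a ε M) (hb : b ε M) :
    Coord M (num 2) (tup a b) (num 0) x ↔ x = a := by
  constructor
  · rintro ⟨-, s, hs, hx⟩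
    obtain ⟨a', b', -, -, e, h, -⟩ := hs.exists_two
    rw [h x hx, (tup_inj.1 e).1]
  · rintro rfl
    obtain ⟨s, hs⟩ := exists_tupleSeq x b
    exact ⟨mem_num_two.2 (.inl rfl), s, isTupleSeq_two_of ha hb hs,
      emp, (hs _).2 (.inl rfl), (hs _).2 (.inr (.inl rfl))⟩

theorem coord_one {M a b x : V} (ha : a ε M) (hb : b ε M) :
    Coord M (num 2) (tup a b) (num 1) x ↔ x = b := by
  constructor
  · rintro ⟨-, s, hs, hx⟩
    obtain ⟨a', b', -, -, e, -, h⟩ := hs.exists_two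
    rw [h x hx, (tup_inj.1 e).2]
  · rintro rfl
    obtain ⟨s, hs⟩ := exists_tupleSeq a x
    exact ⟨mem_num_two.2 (.inr rfl), s, isTupleSeq_two_of ha hb hs,
      _, (hs _).2 (.inr (.inl rfl)), (hs _).2 (.inr (.inr rfl))⟩

/-! ### The atomic formula `R(v₀, v₁)` -/

/-- `a` is the value of the term `t`. -/
def TermVal (M I m h t a : V) : Prop :=
  (∃ i, t = pair (num 0) i ∧ Coord M m h i a) ∨ ∃ c, t = pair (num 1) c ∧ pair c a ε I

/-- The code of the formula `R(v₀, v₁)`. -/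
noncomputable def relCode : V :=
  pair (pair (num 7) (pair (num 0) (num 0))) (pair (num 0) (num 1))

/-- The signature with a binary predicate only. -/
abbrev relSig : Sig := ⟨false, true⟩

variable {n : ℕ} {v : Empty → V} {xs : Fin n → V}

@[simp] theorem realize_tupleStep {s k x : Fin n} :
    (tupleStep s k x).Realize v xs ↔ TupleStep (xs s) (xs k) (xs x) := by
  simp [tupleStep, TupleStep]

@[simp] theorem realize_isTupleSeq {M m h s : Fin n} :
    (isTupleSeq M m h s).Realize v xs ↔ IsTupleSeq (xs M) (xs m) (xs h) (xs s) := by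
  simp [isTupleSeq, IsTupleSeq, and_assoc]

@[simp] theorem realize_isTuple {M m h : Fin n} :
    (isTuple M m h).Realize v xs ↔ IsTuple (xs M) (xs m) (xs h) := by
  simp [isTuple, IsTuple]

@[simp] theorem realize_coord {M m h i x : Fin n} :
    (coord M m h i x).Realize v xs ↔ Coord (xs M) (xs m) (xs h) (xs i) (xs x) := by
  simp [coord, Coord]

@[simp] theorem realize_isVar {t i : Fin n} :
    (isVar t i).Realize v xs ↔ xs t = pair (num 0) (xs i) := by
  simp [isVar]

@[simp] theorem realize_isConst {t a : Fin n} :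
    (isConst t a).Realize v xs ↔ xs t = pair (num 1) (xs a) := by
  simp [isConst]

@[simp] theorem realize_codeEq {y t s : Fin n} :
    (codeEq y t s).Realize v xs ↔ xs y = pair (pair (num 2) (xs t)) (xs s) := by
  simp [codeEq]

@[simp] theorem realize_codeNot {y x : Fin n} :
    (codeNot y x).Realize v xs ↔ xs y = pair (num 3) (xs x) := by
  simp [codeNot]

@[simp] theorem realize_codeAnd {y x₁ x₂ : Fin n} :
    (codeAnd y x₁ x₂).Realize v xs ↔ xs y = pair (pair (num 4) (xs x₁)) (xs x₂) := by
  simp [codeAnd]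

@[simp] theorem realize_codeEx {y i x : Fin n} :
    (codeEx y i x).Realize v xs ↔ xs y = pair (pair (num 5) (xs i)) (xs x) := by
  simp [codeEx]

@[simp] theorem realize_codeU {y t : Fin n} :
    (codeU y t).Realize v xs ↔ xs y = pair (num 6) (xs t) := by
  simp [codeU]

@[simp] theorem realize_codeR {y t s : Fin n} :
    (codeR y t s).Realize v xs ↔ xs y = pair (pair (num 7) (xs t)) (xs s) := by
  simp [codeR]

@[simp] theorem realize_termVal {M I m h t a : Fin n} :
    (termVal M I m h t a).Realize v xs ↔
      TermVal (xs M) (xs I) (xs m) (xs h) (xs t) (xs a) := by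
  simp [termVal, TermVal]

/-- The tag `7` and the nesting of pairs rule out the other five cases of `satStep`. -/
theorem realize_satStep_rel {M U R I m f g k y G : Fin n} {t s : V}
    (hy : xs y = pair (pair (num 7) t) s) :
    (satStep M U R I m f g k y G).Realize v xs ↔ ∀ h, h ε xs G ↔ IsTuple (xs M) (xs m) h ∧
      ∃ a b, TermVal (xs M) (xs I) (xs m) h t a ∧ TermVal (xs M) (xs I) (xs m) h s b ∧
        pair a b ε xs R := by
  simp [satStep, hy, and_assoc]

theorem isAtomic_relCode {A x : Fin n} (hx : xs x = relCode) :
    (isAtomic relSig A x).Realize v xs := by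
  have : ∃ i : V, IsNat i ∧ i = num 0 := ⟨_, isNat_num 0, rfl⟩
  simp [isAtomic, isTerm, hx, relCode, isNat_num]

theorem isFormSeq_relCode {A x f n' : Fin n} (hx : xs x = relCode)
    (hf : xs f = single relCode) (hn : xs n' = num 1) :
    (isFormSeq relSig A x f n').Realize v xs := by
  simp only [isFormSeq, BoundedFormula.realize_inf, realize_Nat, hn, isNat_num, realize_isFunOn,
    hf, isFunOn_single, realize_ex, realize_ball, realize_isSucc, realize_app, Fin.snoc_castSucc,
    Fin.snoc_last, hx, mem_single, pair_inj, and_true, true_and, BoundedFormula.realize_sup]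
  refine ⟨⟨emp, rfl, rfl⟩, fun a ha => ?_⟩
  obtain rfl : a = emp := by simpa [num] using ha
  exact ⟨relCode, ⟨rfl, rfl⟩, .inl (isAtomic_relCode (by simp))⟩

theorem boundsVars_relCode {f m : Fin n} (hf : xs f = single relCode) (hm : xs m = num 2) :
    (boundsVars f m).Realize v xs := by
  simp only [boundsVars, mentions, realize_all, BoundedFormula.realize_imp,
    BoundedFormula.realize_inf, realize_app, realize_mem, Fin.snoc_castSucc, Fin.snoc_last, hf,
    hm, mem_single, pair_inj]
  rintro a b c ⟨⟨rfl, rfl⟩, h⟩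
  rw [mem_num_two]
  obtain ⟨_, ⟨h, -⟩ | ⟨-, h⟩⟩ : ∃ a, c = num 0 ∧ a = pair (num 0) (num 1) ∨
      a = pair (num 0) (num 0) ∧ c = num 1 := by simpa [relCode, eq_comm] using h
  exacts [.inl h, .inr h]

theorem isFormula_relCode {A m x : Fin n} (hx : xs x = relCode) (hm : xs m = num 2) :
    (isFormula relSig A m x).Realize v xs := by
  simp only [isFormula, realize_ex, BoundedFormula.realize_inf]
  exact ⟨single relCode, num 1, isFormSeq_relCode (by simpa) (by simp) (by simp),
    boundsVars_relCode (by simp) (by simpa)⟩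

/-- This is the set of assignments satisfying `R(v₀, v₁)`. To get it by `Δ₀`-Separation, every
intermediate pair in the definition of `tup a b` must be bounded by some set. -/
theorem exists_relSat (M R : V) : ∃ G : V, ∀ h, h ε G ↔
    ∃ a b, a ε M ∧ b ε M ∧ h = tup a b ∧ pair a b ε R := by
  let z (k : Fin 8) {n : ℕ} : Fin 8 ⊕ Fin n := Sum.inl k
  -- `P₁`, `P₂`, `P₃` contain `⟨0, a⟩`, `⟨∅, ⟨0, a⟩⟩` and `⟨1, b⟩` respectively, so `tup a b` lies
  -- in `P₂ × P₃`.
  let P₁ : V := prod (upair emp emp) M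
  let P₂ : V := prod (upair emp emp) P₁
  let P₃ : V := prod (upair (num 1) (num 1)) M
  obtain ⟨G, hG⟩ := exists_sep (V := V) (k := 7)
    (dbex (z 1) fun a => dbex (z 1) fun b => dbex (z 2) fun p => dPair p (up (up a)) (up b) ⊓
      dbex (z 5) fun r => dPair r (z 3) (up (up (up a))) ⊓
        dbex (z 6) fun y => dPair y (z 3) (up r) ⊓
          dbex (z 7) fun q => dPair q (z 4) (up (up (up (up b)))) ⊓ dPair (z 0) (up y) q)
    (.dbex fun _ => .dbex fun _ => .dbex fun _ => (isDelta0_dPair _ _ _).and <|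
      .dbex fun _ => (isDelta0_dPair _ _ _).and <| .dbex fun _ => (isDelta0_dPair _ _ _).and <|
        .dbex fun _ => (isDelta0_dPair _ _ _).and (isDelta0_dPair _ _ _))
    ![M, R, emp, num 1, P₁, P₂, P₃] (prod P₂ P₃)
  refine ⟨G, fun h => (hG h).trans ?_⟩
  have e : (Fin.cons h ![M, R, emp, num 1, P₁, P₂, P₃] : Fin 8 → V) =
    ![h, M, R, emp, num 1, P₁, P₂, P₃] := rfl
  simp only [e, Formula.Realize, realize_dbex, BoundedFormula.realize_inf, realize_dPair,
    elim_snoc_up, Sum.elim_inr, Sum.elim_inl, Fin.snoc_last, z]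
  constructor
  · rintro ⟨-, a, ha, b, hb, p, hp, rfl, r, -, rfl, y, -, rfl, q, -, rfl, hq⟩
    exact ⟨a, b, ha, hb, hq, hp⟩
  · rintro ⟨a, b, ha, hb, rfl, hR⟩
    have h₁ : pair emp a ε P₁ := by simpa [P₁] using ha
    have h₂ : pair emp (pair emp a) ε P₂ := by simpa [P₂] using h₁
    have h₃ : pair (num 1) b ε P₃ := by simpa [P₃] using hb
    exact ⟨mem_prod.2 ⟨_, h₂, _, h₃, rfl⟩, a, ha, b, hb, _, hR, rfl, _, h₁, rfl, _, h₂, rfl,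
      _, h₃, rfl, rfl⟩

theorem termVal_zero {M I a b c : V} (ha : a ε M) (hb : b ε M) :
    TermVal M I (num 2) (tup a b) (pair (num 0) (num 0)) c ↔ c = a := by
  simp [TermVal, coord_zero ha hb]

theorem termVal_one {M I a b c : V} (ha : a ε M) (hb : b ε M) :
    TermVal M I (num 2) (tup a b) (pair (num 0) (num 1)) c ↔ c = b := by
  simp [TermVal, coord_one ha hb]

/-- A witness for `Sat` may be a long formation sequence, but its last entry is `relCode`, and the
clause for `R` determines the last satisfaction set without reference to earlier entries.
Conversely, sequences of length `1` are witnesses. -/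
theorem realize_Sat_relCode {A M U R I m x e : Fin n} {a b : V} (hx : xs x = relCode)
    (hm : xs m = num 2) (ha : a ε xs M) (hb : b ε xs M) (he : xs e = tup a b) :
    (Sat relSig A M U R I m x e).Realize v xs ↔ pair a b ε xs R := by
  simp only [Sat, realize_ex, BoundedFormula.realize_inf, realize_isFunOn, realize_ball,
    realize_app, realize_isSucc, realize_mem, Fin.snoc_castSucc, Fin.snoc_last, he]
  constructor
  · rintro ⟨f, g, n', ⟨⟨⟨h₁, -⟩, hg⟩, hs⟩, k, rfl, G, hG, heG⟩
    simp only [isFormSeq, realize_ex, BoundedFormula.realize_inf, realize_isFunOn, realize_Nat,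
      realize_app, realize_isSucc, Fin.snoc_castSucc, Fin.snoc_last, hx] at h₁
    obtain ⟨⟨⟨hn, hf⟩, k', hk, hfk⟩, -⟩ := h₁
    -- Both indices are the predecessor of the length. Injectivity of the successor holds because
    -- natural numbers are transitive and not members of themselves.
    have hkk : k = k' := by
      have h : k ε succ k' := hk ▸ mem_succ.2 (.inr rfl)
      have h' : k' ε succ k := hk ▸ mem_succ.2 (.inr rfl)
      rcases mem_succ.1 h with h | h
      · rcases mem_succ.1 h' with h' | h'
        · have hk := hn.of_mem (mem_succ.2 (.inr rfl))
          exact absurd (hk.1.1 _ h' _ h) hk.not_mem_self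
        · exact h'.symm
      · exact h
    subst hkk
    obtain ⟨y, G', ⟨hy, hG'⟩, hstep⟩ := hs k (mem_succ.2 (.inr rfl))
    obtain rfl := hf.unique hfk hy
    obtain rfl := hg.unique hG hG'
    rw [realize_satStep_rel (t := pair (num 0) (num 0)) (s := pair (num 0) (num 1))
      (by simp [relCode])] at hstep
    simp only [Fin.snoc_castSucc, Fin.snoc_last, hm] at hstep
    obtain ⟨-, a', b', h, h', hR⟩ := (hstep _).1 heG
    rw [termVal_zero ha hb] at h
    rw [termVal_one ha hb] at h'
    rwa [h, h'] at hR
  · intro hR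
    obtain ⟨G, hG⟩ := exists_relSat (xs M) (xs R)
    refine ⟨single relCode, single G, num 1, ⟨⟨⟨isFormSeq_relCode (by simpa) (by simp) (by simp),
      boundsVars_relCode (by simp) (by simpa)⟩, isFunOn_single G⟩, ?_⟩, emp, rfl, G, by simp,
      (hG _).2 ⟨a, b, ha, hb, rfl, hR⟩⟩
    intro k hk
    obtain rfl : k = emp := by simpa [num] using hk
    refine ⟨relCode, G, ⟨by simp, by simp⟩, ?_⟩
    rw [realize_satStep_rel (t := pair (num 0) (num 0)) (s := pair (num 0) (num 1))
      (by simp [relCode])]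
    simp only [Fin.snoc_castSucc, Fin.snoc_last, hm, hG, isTuple_two]
    intro h
    constructor
    · rintro ⟨a, b, ha, hb, rfl, hR⟩
      exact ⟨⟨a, b, ha, hb, rfl⟩, a, b, (termVal_zero ha hb).2 rfl, (termVal_one ha hb).2 rfl, hR⟩
    · rintro ⟨⟨a, b, ha, hb, rfl⟩, a', b', h, h', hR⟩
      rw [termVal_zero ha hb] at h
      rw [termVal_one ha hb] at h'
      exact ⟨a, b, ha, hb, rfl, h ▸ h' ▸ hR⟩

end Satisfaction

/-! ### Rigid cycles and the application of Vopěnka's Principle -/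

section Cycles

variable {V : Type u} [setLang.Structure V] [V ⊨ EST]

/-- `⟨i, j⟩` is an edge of the directed cycle on `{0, …, n}` with an additional loop at `0`. -/
def IsEdge (n i j : V) : Prop := j = succ i ∨ i = n ∧ j = emp ∨ i = emp ∧ j = emp

/-- `R` is the edge relation of the directed cycle on `{0, …, n}` with a loop at `0`. -/
def IsCycleRel (n R : V) : Prop :=
  ∀ p, p ε R ↔ ∃ i, i ε succ n ∧ ∃ j, j ε succ n ∧ p = pair i j ∧ IsEdge n i j

/-- `X` is the directed cycle on `{0, …, n}` with a loop at `0`, for some `n ≠ 0`. -/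
def IsCycle (X : V) : Prop :=
  ∃ n, IsNat n ∧ n ≠ emp ∧ ∃ R, IsCycleRel n R ∧ X = pair (pair (succ n) R) emp

/-- The formula defining `IsCycle`. -/
def isCycle {n : ℕ} (X : Fin n) : Fm n :=
  ex fun n => Nat n ⊓ ∼(isEmpty n) ⊓ ex fun R =>
    (ex fun M => isSucc M n ⊓
      (all fun p => mem p R ⇔ bex M fun i => bex M fun j => isPair p i j ⊓
        (isSucc j i ⊔ ((eq i n ⊓ isEmpty j) ⊔ (isEmpty i ⊓ isEmpty j)))) ⊓
      (ex fun I => isEmpty I ⊓ isTriple X M R I))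

theorem realize_isCycle {n : ℕ} {v : Empty → V} {xs : Fin n → V} {X : Fin n} :
    (isCycle X).Realize v xs ↔ IsCycle (xs X) := by
  simp [isCycle, IsCycle, IsCycleRel, IsEdge, and_assoc]

theorem IsCycleRel.pair_mem {n R i j : V} (h : IsCycleRel n R) :
    pair i j ε R ↔ i ε succ n ∧ j ε succ n ∧ IsEdge n i j := by
  rw [h]
  constructor
  · rintro ⟨a, ha, b, hb, e, he⟩
    obtain ⟨rfl, rfl⟩ := pair_inj.1 e
    exact ⟨ha, hb, he⟩
  · rintro ⟨hi, hj, he⟩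
    exact ⟨i, hi, j, hj, rfl, he⟩

theorem IsCycleRel.eq {n R R' : V} (h : IsCycleRel n R) (h' : IsCycleRel n R') : R = R' :=
  ext fun p => (h p).trans (h' p).symm

theorem exists_cycleRel (n : V) : ∃ R : V, IsCycleRel n R := by
  let z (k : Fin 4) {n : ℕ} : Fin 4 ⊕ Fin n := Sum.inl k
  obtain ⟨R, hR⟩ := exists_sep (V := V) (k := 3)
    (dbex (z 1) fun i => dbex (z 1) fun j => dPair (z 0) (up i) j ⊓
      (dSucc j (up i) ⊔ ((deq (up i) (z 2) ⊓ dEmpty j) ⊔ (dEmpty (up i) ⊓ dEmpty j))))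
    (.dbex fun _ => .dbex fun _ => (isDelta0_dPair _ _ _).and <| (isDelta0_dSucc _ _).or <|
      ((IsDelta0.deq _ _).and (isDelta0_dEmpty _)).or
        ((isDelta0_dEmpty _).and (isDelta0_dEmpty _)))
    ![succ n, n, emp] (prod (succ n) (succ n))
  refine ⟨R, fun p => (hR p).trans ?_⟩
  have e : (Fin.cons p ![succ n, n, emp] : Fin 4 → V) = ![p, succ n, n, emp] := rfl
  simp only [e, Formula.Realize, realize_dbex, BoundedFormula.realize_inf,
    BoundedFormula.realize_sup, realize_dPair, realize_dSucc, realize_deq, realize_dEmpty,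
    elim_snoc_up, Sum.elim_inr, Sum.elim_inl, Fin.snoc_last, z]
  refine ⟨fun h => h.2, fun h => ⟨?_, h⟩⟩
  obtain ⟨i, hi, j, hj, rfl, -⟩ := h
  exact mem_prod.2 ⟨i, hi, j, hj, rfl⟩

/-- A one-to-one map of one cycle to another that preserves edges is the identity. -/
theorem IsCycleRel.rigid {n k R R' f : V} (hn : IsNat n) (hk : IsNat k) (hne : n ≠ emp)
    (hR : IsCycleRel n R) (hR' : IsCycleRel k R') (hf : IsFunOn f (succ n))
    (hinj : ∀ x y z, pair x z ε f → pair y z ε f → x = y)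
    (hom : ∀ a b a' b', a ε succ n → b ε succ n → pair a a' ε f → pair b b' ε f →
      pair a b ε R → pair a' b' ε R') : n = k := by
  -- The loop at `∅` goes to a loop of the target, and the only loop there is at `∅`, since `y =
  -- succ y` would give `y ε y`.
  have h0 : pair emp emp ε f := by
    have hm := hn.emp_mem_succ
    obtain ⟨y, hy, -⟩ := hf.2 _ hm
    have := hR'.pair_mem.1 (hom _ _ _ _ hm hm hy hy (hR.pair_mem.2 ⟨hm, hm, .inr (.inr ⟨rfl, rfl⟩)⟩))
    rcases this.2.2 with h | h | h
    · have h' : y ε succ y := by simp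
      rw [← h] at h'
      exact absurd h' ((isNat_succ hk).of_mem this.1).not_mem_self
    · exact h.2 ▸ hy
    · exact h.2 ▸ hy
  have hid : ∀ x, IsNat x → x ε succ n → pair x x ε f := by
    intro x hx
    have := nat_induction (V := V) (k := 2) (mem 0 1 ⟹ app 2 0 0) ![succ n, f] ?_ ?_ hx
    · simpa using this
    · simpa using fun _ => h0
    · intro x hx h
      have ih : x ε succ n → pair x x ε f := by simpa using h
      suffices succ x ε succ n → pair (succ x) (succ x) ε f by simpa using this
      intro hs
      have hxn := (isNat_succ hn).1.1 _ hs x (by simp)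
      obtain ⟨y, hy, -⟩ := hf.2 _ hs
      have := hR'.pair_mem.1 (hom _ _ _ _ hxn hs (ih hxn) hy (hR.pair_mem.2 ⟨hxn, hs, .inl rfl⟩))
      -- An edge leaving `x` in the target ends at `succ x` or at `∅`; the value `∅` is already
      -- taken at `∅`.
      have key : y ≠ emp := by
        rintro rfl
        exact succ_ne_emp x (hinj _ _ _ hy h0)
      rcases this.2.2 with h | h | h
      · exact h ▸ hy
      · exact absurd h.2 key
      · exact absurd h.2 key
  -- The closing edge from `n` to `∅` is fixed by `f`, so it is an edge of the target. It is then
  -- either the closing edge there, giving `n = k`, or the loop, which `n ≠ ∅` excludes.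
  have hnn : n ε succ n := by simp
  have := hR'.pair_mem.1 (hom _ _ _ _ hnn hn.emp_mem_succ (hid n hn hnn) h0
    (hR.pair_mem.2 ⟨hnn, hn.emp_mem_succ, .inr (.inl ⟨rfl, rfl⟩)⟩))
  rcases this.2.2 with h | h | h
  · exact absurd h.symm (succ_ne_emp n)
  · exact h.1
  · exact absurd h.1 hne

theorem IsCycle.isLStruct {X : V} (h : IsCycle X) {n : ℕ} {v : Empty → V} {xs : Fin n → V}
    {A Y : Fin n} (hA : xs A = emp) (hY : xs Y = X) : (isLStruct relSig A Y).Realize v xs := by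
  obtain ⟨n, hn, -, R, hR, rfl⟩ := h
  simp only [WeakSet.isLStruct, isStruct, realize_ex, BoundedFormula.realize_inf, realize_sub,
    realize_ball, realize_bex, realize_isPair, realize_isFun, realize_isEmpty, realize_isTriple,
    Fin.snoc_castSucc, Fin.snoc_last, hA, hY]
  -- The first `emp` is the missing predicate `U`; the second is the empty constant assignment, a
  -- function on `A = ∅`.
  refine ⟨succ n, emp, R, emp, ⟨⟨by simp, ?_⟩, by simp [IsFunOn]⟩, rfl, rfl⟩
  intro p hp
  obtain ⟨i, hi, j, hj, e, -⟩ := (hR p).1 hp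
  exact ⟨i, hi, j, hj, e⟩

/-- Elementarity for `R(v₀, v₁)` at the assignments `tup a b` and `tup a' b'` makes the embedding
preserve edges. Rigidity then equates the lengths, and the length determines the cycle. -/
theorem IsCycle.eq_of_elemEmbeds {X X' : V} (h : IsCycle X) (h' : IsCycle X') {n : ℕ}
    {v : Empty → V} {xs : Fin n → V} {A Y Y' : Fin n} (hY : xs Y = X) (hY' : xs Y' = X')
    (H : (elemEmbeds relSig A Y Y').Realize v xs) : X = X' := by
  obtain ⟨n, hn, hne, R, hR, rfl⟩ := h
  obtain ⟨k, hk, -, R', hR', rfl⟩ := h'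
  simp only [elemEmbeds, isStruct, realize_ex, BoundedFormula.realize_inf, realize_isEmpty,
    realize_isTriple, Fin.snoc_castSucc, Fin.snoc_last, hY, hY', pair_inj] at H
  obtain ⟨M, U, R₁, I, M', U', R₂, I', f, ⟨⟨-, -, ⟨hM, h₁⟩, hI⟩, -, -, ⟨hM', h₂⟩, hI'⟩, H⟩ := H
  subst hM h₁ hI hM' h₂ hI'
  simp only [isElemEmb, realize_all, realize_ex, BoundedFormula.realize_inf, realize_isFun,
    BoundedFormula.realize_imp, BoundedFormula.realize_iff, realize_Nat, realize_isTuple,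
    realize_ball, realize_coord, realize_app, realize_isInj,
    Fin.snoc_castSucc, Fin.snoc_last] at H
  obtain ⟨⟨⟨⟨hf, hfk⟩, hinj⟩, -⟩, hel⟩ := H
  suffices n = k by
    subst this
    rw [hR.eq hR']
  refine hR.rigid hn hk hne hR' hf hinj fun a b a' b' ha hb haa hbb hab => ?_
  have ha' := hfk _ ha _ haa
  have hb' := hfk _ hb _ hbb
  have := hel (num 2) relCode (tup a b) (tup a' b') ⟨⟨⟨⟨isNat_num 2,
    isFormula_relCode (by simp) (by simp)⟩, isTuple_two.2 ⟨a, b, ha, hb, rfl⟩⟩,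
    isTuple_two.2 ⟨a', b', ha', hb', rfl⟩⟩, ?_⟩
  · rw [realize_Sat_relCode (a := a) (b := b) (by simp) (by simp)
      (by simpa using ha) (by simpa using hb) (by simp),
      realize_Sat_relCode (a := a') (b := b') (by simp) (by simp)
        (by simpa using ha') (by simpa using hb') (by simp)] at this
    simpa using this.1 (by simpa using hab)
  · intro i hi
    rcases mem_num_two.1 hi with rfl | rfl
    · exact ⟨a, a', ⟨(coord_zero ha hb).2 rfl, (coord_zero ha' hb').2 rfl⟩, haa⟩
    · exact ⟨b, b', ⟨(coord_one ha hb).2 rfl, (coord_one ha' hb').2 rfl⟩, hbb⟩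

theorem exists_omega_of_forall_mem {w : V} (hw : ∀ x, IsNat x → x ε w) :
    ∃ o : V, ∀ x, x ε o ↔ IsNat x := by
  obtain ⟨o, ho⟩ := exists_sep (V := V) (k := 0) (dNat (Sum.inl 0)) (isDelta0_dNat _) ![] w
  refine ⟨o, fun x => (ho x).trans ?_⟩
  simp only [Formula.Realize, realize_dNat, Sum.elim_inl, Fin.cons_zero]
  exact ⟨fun h => h.2, fun h => ⟨hw x h, h⟩⟩

/-- A cycle is `⟨⟨M, R⟩, ∅⟩`. Two unions pass from a Kuratowski pair to its first coordinate, so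
four reach the domain `M` and a fifth its elements. -/
theorem exists_omega_of_cycles_set {c : V} (hc : ∀ X, IsCycle X → X ε c) :
    ∃ o : V, ∀ x, x ε o ↔ IsNat x := by
  refine exists_omega_of_forall_mem
    (w := sUnion (sUnion (sUnion (sUnion (sUnion c))))) fun n hn => ?_
  -- The index `succ n` is nonzero, as `IsCycle` requires, and `n` is a vertex of that cycle.
  obtain ⟨R, hR⟩ := exists_cycleRel (succ n)
  have h := hc _ ⟨succ n, isNat_succ hn, succ_ne_emp n, R, hR, rfl⟩
  simp only [mem_sUnion]
  exact ⟨_, ⟨_, ⟨_, ⟨_, ⟨_, h, singleton_mem_pair _ _⟩, mem_upair.2 (.inl rfl)⟩,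
    singleton_mem_pair _ _⟩, mem_upair.2 (.inl rfl)⟩, by simp⟩

theorem exists_omega [V ⊨ VP] : ∃ o : V, ∀ x, x ε o ↔ IsNat x := by
  by_contra hno
  have := Theory.realize_sentence_of_mem (M := V) VP
    (φ := axVP relSig (isCycle 0).toFormula) ⟨_, _, rfl⟩
  have e (m : ℕ) (xs : Fin m → V) (y : Fin m) : xs ∘ ![y] = ![xs y] := by
    funext i
    simp
  simp only [axVP, Sentence.Realize, Formula.Realize, realize_all, realize_ex,
    BoundedFormula.realize_imp, BoundedFormula.realize_inf, BoundedFormula.realize_sup,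
    BoundedFormula.realize_not, realize_inst, realize_mem, realize_eq, e] at this
  replace this := this emp
  simp only [← Formula.Realize.eq_1, Fm.realize_toFormula, realize_isCycle, Fin.snoc_castSucc,
    Fin.snoc_last, Matrix.cons_val_zero] at this
  -- For properness, a set `c` that agrees with the class of cycles would contain every cycle, and
  -- so would make `ω` a set.
  obtain ⟨X, Y, ⟨⟨hne, hX⟩, hY⟩, h⟩ := this ⟨fun c => by
    by_contra hc
    push Not at hc
    exact hno (exists_omega_of_cycles_set fun X => (hc X).1), fun X hX => hX.isLStruct
    (by simp only [Fin.snoc_castSucc, Fin.snoc_last])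
    (by simp only [Fin.snoc_last])⟩
  exact hne (hX.eq_of_elemEmbeds hY (by simp only [Fin.snoc_castSucc, Fin.snoc_last])
    (by simp only [Fin.snoc_last]) h)

end Cycles

end WeakSet

theorem theorem2 :
    (WeakSet.EST ∪ WeakSet.VP) ⊨ᵇ WeakSet.omegaIsSet ∧ (WeakSet.EST ∪ WeakSet.VP) ⊨ᵇ WeakSet.axInf := by
  constructor
  · intro V v xs
    have : V ⊨ WeakSet.EST := Theory.Model.mono V.is_model Set.subset_union_left
    have : V ⊨ WeakSet.VP := Theory.Model.mono V.is_model Set.subset_union_right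
    simpa only [WeakSet.omegaIsSet, WeakSet.realize_ex, WeakSet.realize_all, BoundedFormula.realize_iff,
      WeakSet.realize_mem, WeakSet.realize_Nat, Fin.snoc_castSucc, Fin.snoc_last] using WeakSet.exists_omega (V := V)
  · intro V v xs
    have : V ⊨ WeakSet.EST := Theory.Model.mono V.is_model Set.subset_union_left
    have : V ⊨ WeakSet.VP := Theory.Model.mono V.is_model Set.subset_union_right
    obtain ⟨o, ho⟩ := WeakSet.exists_omega (V := V)
    simp only [WeakSet.axInf, WeakSet.realize_ex, BoundedFormula.realize_inf, WeakSet.realize_bex,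
      WeakSet.realize_ball, WeakSet.realize_isEmpty, WeakSet.realize_isSucc, Fin.snoc_castSucc,
      Fin.snoc_last]
    -- The set `ω` itself witnesses Infinity.
    exact ⟨o, ⟨_, (ho _).2 WeakSet.isNat_emp, rfl⟩, fun x hx =>
      ⟨_, (ho _).2 (WeakSet.isNat_succ ((ho x).1 hx)), rfl⟩⟩
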